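/- Let $K$ be a field and let $G$ be a complete tripartite graph whose vertex set is the disjoint union of nonempty finite parts $V_1,V_2,V_3$ of sizes $m_1,m_2,m_3$ (two vertices are adjacent if and only if they lie in different parts). Let $R$ be the polynomial ring over $K$ with one variable, of degree $1$, for each vertex of $G$, and let $J_G\subset R$ be the cover ideal of $G$, that is, the ideal generated by the monomials $\prod_{x\in c}x$ for the vertex covers $c$ of $G$. Let $s\ge 2$. Then the graded minimal free resolution of $R/J_G^s$ over $R$ is, up to degree shifts, of the form $$0\to R^{\binom{s}{2}}\to R^{2\binom{s+1}{2}}\to R^{\binom{s+2}{2}}\to R\to 0 .$$ For nonnegative integers $\ell_1,\ell_2,\ell_3$ with $\ell_1+\ell_2+\ell_3=s$ put $\alpha=(s-\ell_3)m_1+(s-\ell_2)m_2+(s-\ell_1)m_3$. Then the Castelnuovo–Mumford regularity $\operatorname{reg}(J_G^s)=\max\{j-i : \operatorname{Tor}_i^R(J_G^s,K)_j\ne 0\}$ is the maximum of all the numbers $$\begin{cases}\alpha, & 0\le \ell_1,\ell_2,\ell_3\le s,\\ \alpha+m_3-1, & 1\le \ell_1\le s,\ 0\le \ell_2,\ell_3\le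 s-1,\\ \alpha+2m_3-2, & 2\le \ell_1\le s,\ 0\le \ell_2,\ell_3\le s-2,\end{cases}$$ taken over all such triples $(\ell_1,\ell_2,\ell_3)$ with $\ell_1+\ell_2+\ell_3=s$. -/

import Mathlib

universe u v w

noncomputable section

open MvPolynomial

/-- `P 0, …, P (k - 1)` are the parts of the complete multipartite graph `G`: they are nonempty, they
partition the vertex set, and two vertices are adjacent exactly when they lie in distinct parts. -/
structure IsCompleteMultipartiteWithParts {V : Type v} {k : ℕ} (G : SimpleGraph V)
    (P : Fin k → Finset V) : Prop where
  nonempty : ∀ i, (P i).Nonempty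
  existsUnique_mem : ∀ a, ∃! i, a ∈ P i
  adj_iff : ∀ a b, G.Adj a b ↔ ∃ i j, i ≠ j ∧ a ∈ P i ∧ b ∈ P j

/-- The cover ideal `J_G ⊆ K[V]`: it is generated by the squarefree monomials `∏_{x ∈ c} x`, where `c`
runs over the vertex covers of `G`. -/
def coverIdeal (K : Type u) [Field K] {V : Type v} (G : SimpleGraph V) : Ideal (MvPolynomial V K) :=
  Ideal.span {f | ∃ c : Finset V, G.IsVertexCover (c : Set V) ∧ f = ∏ x ∈ c, X x}

/-- The standard grading of `K[V]` (every variable has degree one), indexed by `ℤ`; the components of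
negative degree are zero. -/
def polyGrading (K : Type u) [Field K] (V : Type v) (j : ℤ) : Submodule K (MvPolynomial V K) :=
  weightedHomogeneousSubmodule K (fun _ : V => (1 : ℤ)) j

/-- The grading of a homogeneous ideal `I`, as a graded module over the polynomial ring. -/
def idealGrading {K : Type u} [Field K] {V : Type v} (I : Ideal (MvPolynomial V K)) (j : ℤ) :
    Submodule K I :=
  (polyGrading K V j).comap (I.subtype.restrictScalars K)

/-- The grading of the quotient `R ⧸ I` by a homogeneous ideal `I`, as a graded module over the
polynomial ring `R`. -/
def quotientGrading {K : Type u} [Field K] {V : Type v} (I : Ideal (MvPolynomial V K)) (j : ℤ) :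
    Submodule K (MvPolynomial V K ⧸ I) :=
  (polyGrading K V j).map (I.mkQ.restrictScalars K)

/-- A graded free resolution `⋯ → F₂ → F₁ → F₀ → M → 0` of a finitely generated graded module `M`
over `R = K[V]`, with grading `ℳ`, by free modules of finite rank:
`F_i = ⨁_b R(-deg i b)`, with `b` running over a homogeneous basis of `rank i` elements. The
differential `F_{i+1} → F_i` and the augmentation `F₀ → M` preserve degrees. -/
structure GradedFreeResolution {K : Type u} [Field K] (V : Type v) {M : Type w} [AddCommGroup M]
    [Module K M] [Module (MvPolynomial V K) M] (ℳ : ℤ → Submodule K M) where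
  /-- the rank of `F_i` -/
  rank : ℕ → ℕ
  /-- the degrees of the basis elements of `F_i` -/
  deg : ∀ i, Fin (rank i) → ℤ
  /-- the matrix of `F_{i+1} → F_i` -/
  diff : ∀ i, Matrix (Fin (rank i)) (Fin (rank (i + 1))) (MvPolynomial V K)
  /-- the map `F₀ → M` -/
  aug : (Fin (rank 0) → MvPolynomial V K) →ₗ[MvPolynomial V K] M
  diff_mem : ∀ i a b, diff i a b ∈ polyGrading K V (deg (i + 1) b - deg i a)
  aug_mem : ∀ b, aug (Pi.single b 1) ∈ ℳ (deg 0 b)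
  aug_surjective : Function.Surjective aug
  exact_aug : Function.Exact (diff 0).mulVecLin aug
  exact_diff : ∀ i, Function.Exact (diff (i + 1)).mulVecLin (diff i).mulVecLin

namespace GradedFreeResolution

variable {K : Type u} [Field K] {V : Type v} {M : Type w} [AddCommGroup M]
    [Module K M] [Module (MvPolynomial V K) M] {ℳ : ℤ → Submodule K M}

/-- The resolution is minimal: `∂ F_{i+1} ⊆ 𝔪 F_i` for all `i`, where `𝔪` is the ideal generated by
the variables. -/
def IsMinimal (F : GradedFreeResolution V ℳ) : Prop :=
  ∀ i a b, F.diff i a b ∈ Ideal.span (Set.range (X : V → MvPolynomial V K))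

/-- The differential `F_{i+1} ⊗ K → F_i ⊗ K`, where `K = R/𝔪` and `F_i ⊗ K` is identified with the
space of column vectors over `K`. -/
def tensorDiff (F : GradedFreeResolution V ℳ) (i : ℕ) :
    (Fin (F.rank (i + 1)) → K) →ₗ[K] (Fin (F.rank i) → K) :=
  ((F.diff i).map constantCoeff).mulVecLin

/-- The cycles of the complex `F ⊗ K`. -/
def cycles (F : GradedFreeResolution V ℳ) : ∀ i : ℕ, Submodule K (Fin (F.rank i) → K)
  | 0 => ⊤
  | i + 1 => LinearMap.ker (F.tensorDiff i)

/-- The boundaries of the complex `F ⊗ K`. -/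
def boundaries (F : GradedFreeResolution V ℳ) (i : ℕ) : Submodule K (Fin (F.rank i) → K) :=
  LinearMap.range (F.tensorDiff i)

/-- The component of degree `j` of `F_i ⊗ K`: the span of the basis elements of degree `j`. -/
def component (F : GradedFreeResolution V ℳ) (i : ℕ) (j : ℤ) : Submodule K (Fin (F.rank i) → K) where
  carrier := {x | ∀ b, F.deg i b ≠ j → x b = 0}
  add_mem' := by
    intro x y hx hy b hb
    simp [hx b hb, hy b hb]
  zero_mem' := by
    intro b _
    rfl
  smul_mem' := by
    intro c x hx b hb
    simp [hx b hb]

/-- `Tor_i(M, K)_j`: the component of degree `j` of the `i`-th homology of `F ⊗ K`. -/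
abbrev Tor (F : GradedFreeResolution V ℳ) (i : ℕ) (j : ℤ) : Type u :=
  ↥(F.cycles i ⊓ F.component i j) ⧸
    (F.boundaries i).comap (F.cycles i ⊓ F.component i j).subtype

end GradedFreeResolution

/-- `Tor_i(M, K)_j ≠ 0`, for a finitely generated graded module `M` with grading `ℳ` over the
polynomial ring. The spaces `Tor_i(M, K)_j` obtained from two graded free resolutions of `M` are
isomorphic. -/
def TorNonzero {K : Type u} [Field K] (V : Type v) {M : Type w} [AddCommGroup M]
    [Module K M] [Module (MvPolynomial V K) M] (ℳ : ℤ → Submodule K M) (i : ℕ) (j : ℤ) : Prop :=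
  ∃ F : GradedFreeResolution V ℳ, Nontrivial (F.Tor i j)

/-- `t_i(M) = max {j : Tor_i(M, K)_j ≠ 0}`, which is `-∞` if there is no such `j`. -/
def topTorDegree {K : Type u} [Field K] (V : Type v) {M : Type w} [AddCommGroup M]
    [Module K M] [Module (MvPolynomial V K) M] (ℳ : ℤ → Submodule K M) (i : ℕ) : EReal :=
  ⨆ (j : ℤ) (_ : TorNonzero V ℳ i j), ((j : ℝ) : EReal)

/-- The Castelnuovo-Mumford regularity `reg(M) = max {t_i(M) - i : i ≥ 0}` of a finitely generated
graded module `M` with grading `ℳ` over the polynomial ring `K[V]`. -/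
def regularity {K : Type u} [Field K] (V : Type v) {M : Type w} [AddCommGroup M]
    [Module K M] [Module (MvPolynomial V K) M] (ℳ : ℤ → Submodule K M) : EReal :=
  ⨆ i : ℕ, topTorDegree V ℳ i - ((i : ℝ) : EReal)

/-- `α = (s - ℓ₃) m₁ + (s - ℓ₂) m₂ + (s - ℓ₁) m₃`. -/
def tripartiteAlpha (m₁ m₂ m₃ s l₁ l₂ l₃ : ℕ) : ℤ :=
  ((s : ℤ) - l₃) * m₁ + ((s : ℤ) - l₂) * m₂ + ((s : ℤ) - l₁) * m₃

/-- The numbers `α`, `α + m₃ - 1`, `α + 2 m₃ - 2`, where `ℓ₁ + ℓ₂ + ℓ₃ = s` and each of the three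
expressions has its own range of indices. -/
def tripartiteDegrees (m₁ m₂ m₃ s : ℕ) : Set ℤ :=
  {x | ∃ l₁ l₂ l₃ : ℕ, l₁ + l₂ + l₃ = s ∧
    ((l₁ ≤ s ∧ l₂ ≤ s ∧ l₃ ≤ s ∧ x = tripartiteAlpha m₁ m₂ m₃ s l₁ l₂ l₃) ∨
      (1 ≤ l₁ ∧ l₁ ≤ s ∧ l₂ ≤ s - 1 ∧ l₃ ≤ s - 1 ∧
        x = tripartiteAlpha m₁ m₂ m₃ s l₁ l₂ l₃ + m₃ - 1) ∨
      (2 ≤ l₁ ∧ l₁ ≤ s ∧ l₂ ≤ s - 2 ∧ l₃ ≤ s - 2 ∧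
        x = tripartiteAlpha m₁ m₂ m₃ s l₁ l₂ l₃ + 2 * m₃ - 2))}

end

/-!
Write `x_i` for the product of the variables in the `i`-th part, `i = 0, 1, 2`. A vertex cover misses
vertices of at most one part, so `J = J_G` is generated by the pairwise products
`t_i = ∏_{j ≠ i} x_j` (`coverIdeal_eq_span_coProd`), and `x_i t_i = x_0 x_1 x_2` for all `i`.

*The resolution.* Let `S = R[T_0, T_1, T_2]` and `f = x_0 T_0 - x_1 T_1`, `g = x_1 T_1 - x_2 T_2`.
Forms of degree `s` in `T` map onto `J ^ s` by `T_i ↦ t_i`. A form `p` in the kernel satisfies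
`(x_0 x_1 x_2) ^ s p ∈ (f, g)` (`prod_pow_mul_sub_mem_diffIdeal`), and each `x_i` is a nonzerodivisor
modulo `(f, g)` (`IsCoprimeTriple.mem_of_C_mul_mem`), because `x_i, x_j T_j, x_k T_k` are monomials in
disjoint sets of variables. So the kernel is `(f, g)` in degree `s`. As `f` is irreducible and does
not divide `g`, the Koszul complex of `f, g` is exact, and its strand of degree `s`
`0 → S_{s-2} → S_{s-1} ^ 2 → S_s → J ^ s → 0` is a free resolution of `J ^ s` over `R`
(`strandResolution`). The entries of its matrices are `0` or `± x_i`, so it is minimal, also when it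
is continued by `R → R ⧸ J ^ s`.

*Invariance.* Any two free resolutions of a module are homotopy equivalent
(`GradedFreeResolution.exists_chainMap`, `GradedFreeResolution.exists_homotopy`). So minimal
resolutions have equal ranks. The chain map can be replaced by its part of degree zero, so
`Tor_i(I, K)_j ≠ 0` forces a basis element of degree `j` in the `i`-th module of every graded free
resolution of `I`; in a minimal one each basis element gives a nonzero class. Hence the
regularity is the maximum of `deg b - i` over the basis of a minimal resolution
(`GradedFreeResolution.IsMinimal.regularity_eq`), and for the strand these numbers are the listed
ones (`mem_tripartiteDegrees_iff`).
-/

open MvPolynomial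

/-! ### Comparison of free resolutions -/

/-- Dependent choice along `ℕ`, for a sequence of types. -/
lemma exists_seq_of_step {α : ℕ → Type*} {p : ∀ i, α i → Prop} {q : ∀ i, α i → α (i + 1) → Prop}
    (h₀ : ∃ a, p 0 a) (hs : ∀ i a, p i a → ∃ b, p (i + 1) b ∧ q i a b) :
    ∃ f : ∀ i, α i, p 0 (f 0) ∧ ∀ i, q i (f i) (f (i + 1)) := by
  choose a ha using h₀
  choose b hb using hs
  let g : ∀ i, {x : α i // p i x} := fun i =>
    Nat.rec ⟨a, ha⟩ (fun i x => ⟨b i x.1 x.2, (hb i x.1 x.2).1⟩) i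
  exact ⟨fun i => (g i).1, (g 0).2, fun i => (hb i (g i).1 (g i).2).2⟩

/-- Lifting through an exact pair of maps of free modules, one column at a time. -/
lemma Matrix.exists_mul_eq_of_exact {R M : Type*} [CommRing R] [AddCommGroup M] [Module R M]
    {m n o : Type*} [Fintype m] [Fintype n] [Fintype o] [DecidableEq o]
    {A : Matrix m n R} {f : (m → R) →ₗ[R] M} (h : Function.Exact A.mulVecLin f)
    {C : Matrix m o R} (hC : ∀ x, f (C.mulVec x) = 0) : ∃ D : Matrix n o R, A * D = C := by
  choose w hw using fun b : o => (h _).1 (hC (Pi.single b 1))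
  refine ⟨Matrix.of fun a b => w b a, ?_⟩
  ext a b
  have := congrFun (hw b) a
  simpa [Matrix.mul_apply, Matrix.mulVec, dotProduct, Pi.single_apply] using this

namespace GradedFreeResolution

variable {K : Type u} [Field K] {V : Type v} {M : Type w} [AddCommGroup M]
    [Module K M] [Module (MvPolynomial V K) M] {ℳ : ℤ → Submodule K M}

lemma aug_diff_mulVec (F : GradedFreeResolution V ℳ) (x) : F.aug ((F.diff 0).mulVec x) = 0 :=
  F.exact_aug.apply_apply_eq_zero x

lemma diff_mul_diff (F : GradedFreeResolution V ℳ) (i : ℕ) : F.diff i * F.diff (i + 1) = 0 := by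
  refine Matrix.ext_of_mulVec_single fun b => ?_
  rw [← Matrix.mulVec_mulVec, Matrix.zero_mulVec]
  exact (F.exact_diff i).apply_apply_eq_zero _

/-- The identity of `M` lifts to a chain map between any two free resolutions of `M`. -/
lemma exists_chainMap (F F' : GradedFreeResolution V ℳ) :
    ∃ φ : ∀ i, Matrix (Fin (F'.rank i)) (Fin (F.rank i)) (MvPolynomial V K),
      (∀ x, F'.aug ((φ 0).mulVec x) = F.aug x) ∧
        ∀ i, F'.diff i * φ (i + 1) = φ i * F.diff i := by
  refine exists_seq_of_step
    (α := fun i => Matrix (Fin (F'.rank i)) (Fin (F.rank i)) (MvPolynomial V K))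
    (p := fun i => match i with
      | 0 => fun a => ∀ x, F'.aug (a.mulVec x) = F.aug x
      | i + 1 => fun (a : Matrix (Fin (F'.rank (i + 1))) (Fin (F.rank (i + 1))) _) =>
        F'.diff i * (a * F.diff (i + 1)) = 0)
    (q := fun i a b => F'.diff i * b = a * F.diff i) ?_ ?_
  · choose y hy using fun b => F'.aug_surjective (F.aug (Pi.single b 1))
    refine ⟨Matrix.of fun a b => y b a, fun x => ?_⟩
    have : F'.aug ∘ₗ (Matrix.of fun a b => y b a).mulVecLin = F.aug := by
      refine (Pi.basisFun (MvPolynomial V K) _).ext fun b => ?_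
      rw [Pi.basisFun_apply, ← hy b, LinearMap.comp_apply, Matrix.mulVecLin_apply]
      congr 1
      ext a
      simp
    exact LinearMap.congr_fun this x
  · intro i a ha
    obtain ⟨b, hb⟩ : ∃ b : Matrix (Fin (F'.rank (i + 1))) (Fin (F.rank (i + 1)))
        (MvPolynomial V K), F'.diff i * b = a * F.diff i := by
      cases i with
      | zero =>
        refine Matrix.exists_mul_eq_of_exact F'.exact_aug fun x => ?_
        rw [← Matrix.mulVec_mulVec, ha, aug_diff_mulVec]
      | succ i =>
        refine Matrix.exists_mul_eq_of_exact (F'.exact_diff i) fun x => ?_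
        rw [Matrix.mulVecLin_apply, Matrix.mulVec_mulVec, ha, Matrix.zero_mulVec]
    refine ⟨b, ?_, hb⟩
    change F'.diff i * (b * F.diff (i + 1)) = 0
    rw [← Matrix.mul_assoc, hb, Matrix.mul_assoc, diff_mul_diff, Matrix.mul_zero]

/-- A chain endomorphism of a free resolution that lifts the zero map is null-homotopic. -/
lemma exists_homotopy (F : GradedFreeResolution V ℳ)
    (θ : ∀ i, Matrix (Fin (F.rank i)) (Fin (F.rank i)) (MvPolynomial V K))
    (h₀ : ∀ x, F.aug ((θ 0).mulVec x) = 0)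
    (hθ : ∀ i, F.diff i * θ (i + 1) = θ i * F.diff i) :
    ∃ η : ∀ i, Matrix (Fin (F.rank (i + 1))) (Fin (F.rank i)) (MvPolynomial V K),
      θ 0 = F.diff 0 * η 0 ∧ ∀ i, θ (i + 1) = F.diff (i + 1) * η (i + 1) + η i * F.diff i := by
  refine Exists.imp (fun η hη => ⟨hη.1.1 rfl, hη.2⟩) (exists_seq_of_step
    (α := fun i => Matrix (Fin (F.rank (i + 1))) (Fin (F.rank i)) (MvPolynomial V K))
    (p := fun i a => (i = 0 → θ i = F.diff i * a) ∧ (θ i - F.diff i * a) * F.diff i = 0)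
    (q := fun i a b => θ (i + 1) = F.diff (i + 1) * b + a * F.diff i) ?_ ?_)
  · obtain ⟨a, ha⟩ := Matrix.exists_mul_eq_of_exact F.exact_aug h₀
    exact ⟨a, fun _ => ha.symm, by rw [ha, sub_self, Matrix.zero_mul]⟩
  · rintro i a ⟨-, ha⟩
    obtain ⟨b, hb⟩ : ∃ b : Matrix (Fin (F.rank (i + 1 + 1))) (Fin (F.rank (i + 1)))
        (MvPolynomial V K), F.diff (i + 1) * b = θ (i + 1) - a * F.diff i := by
      refine Matrix.exists_mul_eq_of_exact (F.exact_diff i) fun x => ?_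
      rw [Matrix.mulVecLin_apply, Matrix.mulVec_mulVec, Matrix.mul_sub, hθ, ← Matrix.mul_assoc,
        ← Matrix.sub_mul, ha, Matrix.zero_mulVec]
    refine ⟨b, ⟨fun h => absurd h (Nat.succ_ne_zero i), ?_⟩, by rw [hb, sub_add_cancel]⟩
    rw [hb, sub_sub_cancel, Matrix.mul_assoc, diff_mul_diff, Matrix.mul_zero]

/-- A chain map `F → F` lifting the identity of `M` induces on `F ⊗ K` a map that moves each cycle
by a boundary. -/
lemma mulVec_sub_mem_boundaries (F : GradedFreeResolution V ℳ)
    (θ : ∀ i, Matrix (Fin (F.rank i)) (Fin (F.rank i)) (MvPolynomial V K))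
    (h₀ : ∀ x, F.aug ((θ 0).mulVec x) = F.aug x)
    (hθ : ∀ i, F.diff i * θ (i + 1) = θ i * F.diff i) (i : ℕ) {x : Fin (F.rank i) → K}
    (hx : x ∈ F.cycles i) :
    ((θ i).map constantCoeff).mulVec x - x ∈ F.boundaries i := by
  obtain ⟨η, hη₀, hη⟩ := F.exists_homotopy (fun i => θ i - 1)
    (fun x => by rw [Matrix.sub_mulVec, map_sub, h₀, Matrix.one_mulVec, sub_self])
    (fun i => by rw [Matrix.mul_sub, Matrix.sub_mul, hθ, Matrix.mul_one, Matrix.one_mul])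
  have key : ((θ i).map constantCoeff).mulVec x - x
      = (((θ i - 1).map constantCoeff)).mulVec x := by
    rw [Matrix.map_sub _ (by simp), Matrix.sub_mulVec, Matrix.map_one _ (by simp) (by simp),
      Matrix.one_mulVec]
  rw [key]
  cases i with
  | zero =>
    rw [hη₀, Matrix.map_mul, ← Matrix.mulVec_mulVec]
    exact ⟨_, rfl⟩
  | succ i =>
    have hx' : ((F.diff i).map constantCoeff).mulVec x = 0 := hx
    rw [hη, Matrix.map_add _ (by simp), Matrix.map_mul, Matrix.map_mul, Matrix.add_mulVec,
      ← Matrix.mulVec_mulVec, ← Matrix.mulVec_mulVec, hx', Matrix.mulVec_zero, add_zero]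
    exact ⟨_, rfl⟩

lemma IsMinimal.tensorDiff_eq_zero {F : GradedFreeResolution V ℳ} (hF : F.IsMinimal) (i : ℕ) :
    F.tensorDiff i = 0 := by
  have : (F.diff i).map constantCoeff = 0 := by
    ext a b
    have h : Ideal.span (Set.range (X : V → MvPolynomial V K)) ≤ RingHom.ker constantCoeff := by
      rw [Ideal.span_le]
      rintro _ ⟨v, rfl⟩
      simp
    exact h (hF i a b)
  rw [tensorDiff, this, Matrix.mulVecLin_zero]

lemma IsMinimal.boundaries_eq_bot {F : GradedFreeResolution V ℳ} (hF : F.IsMinimal) (i : ℕ) :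
    F.boundaries i = ⊥ := by
  rw [boundaries, hF.tensorDiff_eq_zero, LinearMap.range_zero]

lemma IsMinimal.cycles_eq_top {F : GradedFreeResolution V ℳ} (hF : F.IsMinimal) (i : ℕ) :
    F.cycles i = ⊤ := by
  cases i with
  | zero => rfl
  | succ i => rw [cycles, hF.tensorDiff_eq_zero, LinearMap.ker_zero]

lemma IsMinimal.rank_le {F F' : GradedFreeResolution V ℳ} (hF : F.IsMinimal) (i : ℕ) :
    F.rank i ≤ F'.rank i := by
  obtain ⟨φ, hφ₀, hφ⟩ := F.exists_chainMap F'
  obtain ⟨ψ, hψ₀, hψ⟩ := F'.exists_chainMap F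
  have h : ∀ x, ((ψ i * φ i).map constantCoeff).mulVec x = x := fun x => by
    have := F.mulVec_sub_mem_boundaries (fun i => ψ i * φ i)
      (fun x => by rw [← Matrix.mulVec_mulVec, hψ₀, hφ₀])
      (fun i => by rw [← Matrix.mul_assoc, hψ, Matrix.mul_assoc, hφ, Matrix.mul_assoc]) i
      (x := x) (by rw [hF.cycles_eq_top]; trivial)
    rw [hF.boundaries_eq_bot, Submodule.mem_bot] at this
    exact sub_eq_zero.1 this
  have hinj : Function.Injective ((φ i).map constantCoeff).mulVecLin := by
    refine Function.LeftInverse.injective (g := ((ψ i).map constantCoeff).mulVecLin) fun x => ?_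
    rw [Matrix.mulVecLin_apply, Matrix.mulVecLin_apply, Matrix.mulVec_mulVec, ← Matrix.map_mul, h]
  simpa using LinearMap.finrank_le_finrank_of_injective hinj

/-- Two minimal free resolutions of the same module have the same ranks. -/
lemma IsMinimal.rank_eq {F F' : GradedFreeResolution V ℳ} (hF : F.IsMinimal) (hF' : F'.IsMinimal)
    (i : ℕ) : F.rank i = F'.rank i :=
  le_antisymm (hF.rank_le i) (hF'.rank_le i)

lemma IsMinimal.nontrivial_tor {F : GradedFreeResolution V ℳ} (hF : F.IsMinimal) (i : ℕ)
    (b : Fin (F.rank i)) : Nontrivial (F.Tor i (F.deg i b)) := by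
  rw [Submodule.Quotient.nontrivial_iff, Ne, Submodule.comap_subtype_eq_top,
    hF.boundaries_eq_bot, hF.cycles_eq_top]
  intro h
  have : (Pi.single b 1 : Fin (F.rank i) → K) ∈ F.component i (F.deg i b) := by
    intro c hc
    exact Pi.single_eq_of_ne (fun h => hc (by rw [h])) _
  have := h ⟨trivial, this⟩
  simpa using (Submodule.mem_bot K).1 this

end GradedFreeResolution

/-! ### Homogeneous components of matrices -/

section GradedPart

variable {K : Type u} [Field K] {V : Type v}

lemma weightedHomogeneousComponent_mul_of_left_mem {i : ℤ} {a : MvPolynomial V K}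
    (ha : a ∈ polyGrading K V i) (b : MvPolynomial V K) (j : ℤ) :
    weightedHomogeneousComponent (fun _ : V => (1 : ℤ)) (i + j) (a * b) =
      a * weightedHomogeneousComponent (fun _ : V => (1 : ℤ)) j b := by
  let _ := weightedGradedAlgebra K (fun _ : V => (1 : ℤ))
  have := DirectSum.coe_decompose_mul_add_of_left_mem
    (weightedHomogeneousSubmodule K (fun _ : V => (1 : ℤ))) (j := j) (b := b) ha
  rwa [← weightedDecomposition.decompose'_apply, ← weightedDecomposition.decompose'_apply]

/-- The part of degree zero of a matrix, viewed as a map between free modules with bases of degrees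
`q` and `p`. -/
noncomputable def gradedPart {m n : Type*} (p : m → ℤ) (q : n → ℤ)
    (A : Matrix m n (MvPolynomial V K)) : Matrix m n (MvPolynomial V K) :=
  Matrix.of fun a b => weightedHomogeneousComponent (fun _ : V => (1 : ℤ)) (q b - p a) (A a b)

variable {l m n : Type*} {o : l → ℤ} {p : m → ℤ} {q : n → ℤ}

lemma gradedPart_mem (A : Matrix m n (MvPolynomial V K)) (a : m) (b : n) :
    gradedPart p q A a b ∈ polyGrading K V (q b - p a) :=
  weightedHomogeneousComponent_mem _ _ _

lemma gradedPart_eq_self {A : Matrix m n (MvPolynomial V K)}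
    (hA : ∀ a b, A a b ∈ polyGrading K V (q b - p a)) : gradedPart p q A = A := by
  ext1 a b
  exact weightedHomogeneousComponent_eq_self (hA a b)

lemma gradedPart_mul_of_left [Fintype m] {A : Matrix l m (MvPolynomial V K)}
    (hA : ∀ a b, A a b ∈ polyGrading K V (p b - o a)) (B : Matrix m n (MvPolynomial V K)) :
    gradedPart o q (A * B) = A * gradedPart p q B := by
  ext1 a b
  simp only [gradedPart, Matrix.of_apply, Matrix.mul_apply, map_sum]
  refine Finset.sum_congr rfl fun c _ => ?_
  rw [← weightedHomogeneousComponent_mul_of_left_mem (hA a c)]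
  congr 2
  ring

lemma gradedPart_mul_of_right [Fintype m] {B : Matrix m n (MvPolynomial V K)}
    (hB : ∀ a b, B a b ∈ polyGrading K V (q b - p a)) (A : Matrix l m (MvPolynomial V K)) :
    gradedPart o q (A * B) = gradedPart o p A * B := by
  ext1 a b
  simp only [gradedPart, Matrix.of_apply, Matrix.mul_apply, map_sum]
  refine Finset.sum_congr rfl fun c _ => ?_
  rw [mul_comm, mul_comm _ (B c b), ← weightedHomogeneousComponent_mul_of_left_mem (hB c b)]
  congr 2
  ring

end GradedPart

namespace GradedFreeResolution

variable {K : Type u} [Field K] {V : Type v} {I : Ideal (MvPolynomial V K)}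

/-- The images of the basis of `F₀` in the ideal, as a matrix with one row. -/
noncomputable def augRow (F : GradedFreeResolution V (idealGrading I)) :
    Matrix Unit (Fin (F.rank 0)) (MvPolynomial V K) :=
  Matrix.of fun _ b => (F.aug (Pi.single b 1) : MvPolynomial V K)

lemma augRow_mem (F : GradedFreeResolution V (idealGrading I)) (a : Unit) (b : Fin (F.rank 0)) :
    F.augRow a b ∈ polyGrading K V (F.deg 0 b - 0) := by
  rw [sub_zero]
  exact F.aug_mem b

lemma augRow_mulVec (F : GradedFreeResolution V (idealGrading I))
    (x : Fin (F.rank 0) → MvPolynomial V K) : F.augRow.mulVec x = fun _ => (F.aug x).1 := by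
  have : F.augRow.mulVecLin = LinearMap.pi fun _ => I.subtype ∘ₗ F.aug := by
    refine (Pi.basisFun (MvPolynomial V K) _).ext fun b => ?_
    ext1 u
    simp [augRow]
  exact LinearMap.congr_fun this x

/-- The identity of a homogeneous ideal lifts to a degree-preserving chain map between any two
graded free resolutions: the part of degree zero of any chain map is one. -/
lemma exists_gradedChainMap (F F' : GradedFreeResolution V (idealGrading I)) :
    ∃ φ : ∀ i, Matrix (Fin (F'.rank i)) (Fin (F.rank i)) (MvPolynomial V K),
      (∀ i a b, φ i a b ∈ polyGrading K V (F.deg i b - F'.deg i a)) ∧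
      (∀ x, F'.aug ((φ 0).mulVec x) = F.aug x) ∧
        ∀ i, F'.diff i * φ (i + 1) = φ i * F.diff i := by
  obtain ⟨φ, hφ₀, hφ⟩ := F.exists_chainMap F'
  refine ⟨fun i => gradedPart (F'.deg i) (F.deg i) (φ i), fun i => gradedPart_mem _,
    fun x => ?_, fun i => ?_⟩
  · have h : F'.augRow * φ 0 = F.augRow := by
      refine Matrix.ext_of_mulVec_single fun b => ?_
      rw [← Matrix.mulVec_mulVec, augRow_mulVec, augRow_mulVec, hφ₀]
    have h' : F'.augRow * gradedPart (F'.deg 0) (F.deg 0) (φ 0) = F.augRow := by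
      rw [← gradedPart_mul_of_left F'.augRow_mem, h, gradedPart_eq_self F.augRow_mem]
    have := congrArg (Matrix.mulVec · x) h'
    simp only [← Matrix.mulVec_mulVec, augRow_mulVec] at this
    exact Subtype.ext (congrFun this ())
  · rw [← gradedPart_mul_of_left (F'.diff_mem i), hφ, gradedPart_mul_of_right (F.diff_mem i)]

/-- If `Tor_i(I, K)_j ≠ 0`, then the `i`-th module of any graded free resolution of `I` has a basis
element of degree `j`. -/
lemma exists_deg_eq_of_torNonzero {i : ℕ} {j : ℤ} (h : TorNonzero V (idealGrading I) i j)
    (F' : GradedFreeResolution V (idealGrading I)) : ∃ b, F'.deg i b = j := by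
  obtain ⟨F, hF⟩ := h
  obtain ⟨φ, hφd, hφ₀, hφ⟩ := F.exists_gradedChainMap F'
  obtain ⟨ψ, hψ₀, hψ⟩ := F'.exists_chainMap F
  rw [Submodule.Quotient.nontrivial_iff, Ne, Submodule.comap_subtype_eq_top,
    SetLike.not_le_iff_exists] at hF
  obtain ⟨x, ⟨hxc, hxj⟩, hx⟩ := hF
  by_contra! hj
  -- without basis elements of degree `j`, `φ ⊗ K` kills `x`, while `ψφ ⊗ K` moves it by a boundary
  refine hx ?_
  have hzero : ((φ i).map constantCoeff).mulVec x = 0 := by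
    ext a
    simp only [Matrix.mulVec, dotProduct, Matrix.map_apply, Pi.zero_apply]
    refine Finset.sum_eq_zero fun b _ => ?_
    by_cases hb : F.deg i b = j
    · have : constantCoeff (φ i a b) = 0 := by
        refine IsWeightedHomogeneous.coeff_eq_zero (hφd i a b) 0 ?_
        rw [map_zero, hb]
        exact (sub_ne_zero.2 (hj a).symm).symm
      rw [this, zero_mul]
    · rw [hxj b hb, mul_zero]
  have := F.mulVec_sub_mem_boundaries (fun i => ψ i * φ i)
      (fun x => by rw [← Matrix.mulVec_mulVec, hψ₀, hφ₀])
      (fun i => by rw [← Matrix.mul_assoc, hψ, Matrix.mul_assoc, hφ, Matrix.mul_assoc]) i hxc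
  rwa [Matrix.map_mul, ← Matrix.mulVec_mulVec, hzero, Matrix.mulVec_zero, zero_sub,
    neg_mem_iff] at this

/-- A graded free resolution of a homogeneous ideal `I`, continued by `R → R ⧸ I`. -/
noncomputable def quotientResolution (F : GradedFreeResolution V (idealGrading I)) :
    GradedFreeResolution V (quotientGrading I) where
  rank
    | 0 => 1
    | i + 1 => F.rank i
  deg
    | 0 => fun _ => 0
    | i + 1 => F.deg i
  diff
    | 0 => Matrix.of fun _ b => (F.aug (Pi.single b 1) : MvPolynomial V K)
    | i + 1 => F.diff i
  aug := I.mkQ ∘ₗ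
    (LinearMap.proj 0 : (Fin 1 → MvPolynomial V K) →ₗ[MvPolynomial V K] MvPolynomial V K)
  diff_mem
    | 0 => fun _ => F.augRow_mem ()
    | i + 1 => F.diff_mem i
  aug_mem b := by
    refine ⟨1, isWeightedHomogeneous_one _ _, ?_⟩
    obtain rfl : b = 0 := Subsingleton.elim _ _
    simp
  aug_surjective x := by
    obtain ⟨y, rfl⟩ := I.mkQ_surjective x
    exact ⟨fun _ => y, rfl⟩
  exact_aug x := by
    have h (y) : (Matrix.of fun (_ : Fin 1) b => (F.aug (Pi.single b 1) : MvPolynomial V K)).mulVec y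
        = fun _ => (F.aug y).1 := funext fun _ => congrFun (F.augRow_mulVec y) ()
    rw [LinearMap.comp_apply, Submodule.mkQ_apply, Submodule.Quotient.mk_eq_zero]
    constructor
    · intro hx
      obtain ⟨y, hy⟩ := F.aug_surjective ⟨_, hx⟩
      refine ⟨y, ?_⟩
      ext a
      obtain rfl : a = 0 := Subsingleton.elim _ _
      rw [Matrix.mulVecLin_apply, h, hy]
      rfl
    · rintro ⟨y, rfl⟩
      rw [Matrix.mulVecLin_apply, h]
      exact (F.aug y).2
  exact_diff
    | 0 => fun x => by
      rw [← F.exact_aug x]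
      have h : (Matrix.of fun (_ : Fin 1) b => (F.aug (Pi.single b 1) : MvPolynomial V K)).mulVec x
          = fun _ => (F.aug x).1 := funext fun _ => congrFun (F.augRow_mulVec x) ()
      rw [Matrix.mulVecLin_apply, h]
      exact ⟨fun e => Subtype.ext (congrFun e 0), fun e => by rw [e]; rfl⟩
    | i + 1 => F.exact_diff i

end GradedFreeResolution

/-! ### The relations between the products of pairs of a regular sequence of length three -/

section Syzygies

variable {R : Type*} [CommRing R]

/-- The ideal generated by the differences `x_i T_i - x_j T_j` in `R[T_0, T_1, T_2]`. -/
noncomputable def diffIdeal (x : Fin 3 → R) : Ideal (MvPolynomial (Fin 3) R) :=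
  Ideal.span {z | ∃ i j, z = C (x i) * X i - C (x j) * X j}

/-- The product of the entries of `x` other than `x_i`. -/
def coProd (x : Fin 3 → R) (i : Fin 3) : R := ∏ j ∈ {i}ᶜ, x j

lemma mul_coProd (x : Fin 3 → R) (i : Fin 3) : x i * coProd x i = ∏ j, x j :=
  Fintype.prod_eq_mul_prod_compl i x |>.symm

/-- For distinct `i, j, k`, the element `x_j T_j` of `R[T_0, T_1, T_2]` is a nonzerodivisor modulo
`x_i`, and `x_k T_k` is one modulo `(x_i, x_j T_j)`. -/
structure IsCoprimeTriple (x : Fin 3 → R) : Prop where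
  dvd_of_dvd_mul : ∀ i j, i ≠ j → ∀ q : MvPolynomial (Fin 3) R,
    C (x i) ∣ C (x j) * X j * q → C (x i) ∣ q
  exists_of_mul_eq : ∀ i j k, i ≠ j → i ≠ k → j ≠ k → ∀ v a b : MvPolynomial (Fin 3) R,
    C (x k) * X k * v = C (x i) * a + C (x j) * X j * b →
      ∃ a' b', v = C (x i) * a' + C (x j) * X j * b'

lemma mem_diffIdeal_iff (x : Fin 3 → R) {i j k : Fin 3} (hij : i ≠ j) (hik : i ≠ k) (hjk : j ≠ k)
    {p : MvPolynomial (Fin 3) R} :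
    p ∈ diffIdeal x ↔ ∃ u v, u * (C (x i) * X i - C (x j) * X j) +
      v * (C (x j) * X j - C (x k) * X k) = p := by
  rw [← Ideal.mem_span_pair]
  suffices h : diffIdeal x = Ideal.span {C (x i) * X i - C (x j) * X j,
      C (x j) * X j - C (x k) * X k} by rw [h]
  refine le_antisymm (Ideal.span_le.2 ?_) (Ideal.span_le.2 ?_)
  · have key : ∀ a, (C (x a) * X a - C (x j) * X j : MvPolynomial (Fin 3) R) ∈
        Ideal.span {C (x i) * X i - C (x j) * X j, C (x j) * X j - C (x k) * X k} := by
      intro a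
      obtain rfl | rfl | rfl : a = i ∨ a = j ∨ a = k := by omega
      · exact Ideal.subset_span (by simp)
      · rw [sub_self]
        exact zero_mem _
      · rw [← neg_sub (C (x j) * X j) (C (x a) * X a), Ideal.neg_mem_iff]
        exact Ideal.subset_span (Set.mem_insert_of_mem _ rfl)
    rintro _ ⟨a, b, rfl⟩
    rw [← sub_sub_sub_cancel_right (C (x a) * X a) (C (x b) * X b) (C (x j) * X j)]
    exact sub_mem (key a) (key b)
  · rintro _ (rfl | rfl)
    · exact Ideal.subset_span ⟨i, j, rfl⟩
    · exact Ideal.subset_span ⟨j, k, rfl⟩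

variable [IsDomain R] {x : Fin 3 → R}

/-- Each `x_i` is a nonzerodivisor modulo the ideal of the differences `x_a T_a - x_b T_b`. -/
lemma IsCoprimeTriple.mem_of_C_mul_mem (hx : IsCoprimeTriple x) (hx₀ : ∀ i, x i ≠ 0) (i : Fin 3)
    {p : MvPolynomial (Fin 3) R} (hp : C (x i) * p ∈ diffIdeal x) : p ∈ diffIdeal x := by
  obtain ⟨j, k, hij, hik, hjk⟩ : ∃ j k, i ≠ j ∧ i ≠ k ∧ j ≠ k := by
    clear hp; revert i; decide
  rw [mem_diffIdeal_iff x hij hik hjk] at hp ⊢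
  obtain ⟨u, v, h⟩ := hp
  -- modulo `x_i` the relation reads `(v - u) x_j T_j = v x_k T_k`
  obtain ⟨a, b, hv⟩ := hx.exists_of_mul_eq i j k hij hik hjk v (X i * u - p) (v - u)
    (by linear_combination -h)
  obtain ⟨c, hc⟩ := hx.dvd_of_dvd_mul i j hij (v - u - C (x k) * X k * b)
    ⟨p - X i * u + C (x k) * X k * a, by
      linear_combination h + C (x k) * X k * hv⟩
  refine ⟨a - c, X i * b + a, ?_⟩
  refine mul_left_cancel₀ (C_ne_zero.2 (hx₀ i)) ?_
  linear_combination h - (C (x i) * X i - C (x k) * X k) * hv + (C (x i) * X i - C (x j) * X j) * hc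

omit [IsDomain R] in
/-- After multiplication by a power of `x_0 x_1 x_2`, a form in `T` becomes its value at the pairwise
products, up to the differences `x_i T_i - x_j T_j`. -/
lemma prod_pow_mul_sub_mem_diffIdeal (x : Fin 3 → R) {s : ℕ} {p : MvPolynomial (Fin 3) R}
    (hp : p.IsHomogeneous s) :
    C (∏ j, x j) ^ s * p - C (aeval (coProd x) p) * (C (x 0) * X 0) ^ s ∈ diffIdeal x := by
  rw [← Ideal.Quotient.mk_eq_mk_iff_sub_mem]
  have hY : ∀ i, Ideal.Quotient.mk (diffIdeal x) (C (x i) * X i) =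
      Ideal.Quotient.mk (diffIdeal x) (C (x 0) * X 0) := fun i =>
    Ideal.Quotient.mk_eq_mk_iff_sub_mem _ _ |>.2 (Ideal.subset_span ⟨i, 0, rfl⟩)
  conv_lhs => rw [p.as_sum]
  conv_rhs => rw [p.as_sum]
  simp only [map_sum, Finset.mul_sum, Finset.sum_mul]
  refine Finset.sum_congr rfl fun l hl => ?_
  have hs : s = ∑ i, l i := by
    rw [hp.degree_eq_sum_deg_support hl]
    exact Finsupp.degree_eq_sum l
  have h₁ : C (∏ j, x j) ^ s * monomial l (coeff l p) =
      C (coeff l p) * ∏ i, (C (coProd x i) * (C (x i) * X i)) ^ l i := by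
    rw [monomial_eq, Finsupp.prod_fintype _ _ (by simp), hs, ← Finset.prod_pow_eq_pow_sum,
      mul_left_comm, ← Finset.prod_mul_distrib]
    congr 1
    refine Finset.prod_congr rfl fun i _ => ?_
    rw [← mul_pow, ← mul_coProd x i, C_mul]
    ring
  have h₂ : C (aeval (coProd x) (monomial l (coeff l p))) * (C (x 0) * X (0 : Fin 3)) ^ s =
      C (coeff l p) * ∏ i, (C (coProd x i) * (C (x 0) * X 0)) ^ l i := by
    rw [aeval_monomial, Finsupp.prod_fintype _ _ (by simp), hs, ← Finset.prod_pow_eq_pow_sum]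
    simp only [mul_pow, Finset.prod_mul_distrib, map_mul, map_prod, map_pow, Algebra.algebraMap_self,
      RingHom.id_apply]
    ring
  rw [h₁, h₂]
  simp only [map_mul, map_prod, map_pow] at hY ⊢
  simp only [hY]

/-- The relations between the pairwise products of `x_0, x_1, x_2` are generated by the
differences `x_i T_i - x_j T_j`. -/
lemma IsCoprimeTriple.mem_diffIdeal_of_aeval_eq_zero (hx : IsCoprimeTriple x) (hx₀ : ∀ i, x i ≠ 0)
    {s : ℕ} {p : MvPolynomial (Fin 3) R} (hp : p.IsHomogeneous s)
    (h : aeval (coProd x) p = 0) : p ∈ diffIdeal x := by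
  have key := prod_pow_mul_sub_mem_diffIdeal x hp
  rw [h, C_0, zero_mul, sub_zero] at key
  have hprod : ∀ q, C (∏ j, x j) * q ∈ diffIdeal x → q ∈ diffIdeal x := fun q hq => by
    rw [Fin.prod_univ_three, C_mul, C_mul, mul_assoc, mul_assoc] at hq
    exact hx.mem_of_C_mul_mem hx₀ 2 (hx.mem_of_C_mul_mem hx₀ 1 (hx.mem_of_C_mul_mem hx₀ 0 hq))
  clear h hp
  induction s with
  | zero => simpa using key
  | succ s ih =>
    rw [pow_succ', mul_assoc] at key
    exact ih (hprod _ key)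

/-- The linear form `x_i T_i - x_j T_j`. -/
noncomputable def diffForm (x : Fin 3 → R) (i j : Fin 3) : MvPolynomial (Fin 3) R :=
  C (x i) * X i - C (x j) * X j

omit [IsDomain R] in
lemma diffForm_isHomogeneous (x : Fin 3 → R) (i j : Fin 3) : (diffForm x i j).IsHomogeneous 1 :=
  (isHomogeneous_C_mul_X _ _).sub (isHomogeneous_C_mul_X _ _)

lemma IsCoprimeTriple.irreducible_diffForm (hx : IsCoprimeTriple x) (hx₀ : ∀ i, x i ≠ 0) :
    Irreducible (diffForm x 0 1) := by
  rw [diffForm, sub_eq_add_neg]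
  refine irreducible_mul_X_add _ _ 0 (C_ne_zero.2 (hx₀ 0)) (by simp) ?_ ?_
  · intro h
    rw [vars_neg] at h
    simpa using vars_mul _ _ h
  · -- if `x_0 = d a` and `-x_1 T_1 = d b`, then `x_0` divides `x_1 T_1 a`, hence divides `a`
    rintro d ⟨a, ha⟩ ⟨b, hb⟩
    obtain ⟨c, hc⟩ := hx.dvd_of_dvd_mul 0 1 (by decide) a ⟨-b, by
      linear_combination -a * hb + b * ha⟩
    have ha₀ : a ≠ 0 := by
      rintro rfl
      exact hx₀ 0 (C_eq_zero.1 (ha.trans (mul_zero d)))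
    refine IsUnit.of_mul_eq_one c (mul_left_cancel₀ ha₀ ?_)
    linear_combination -hc - c * ha

omit [IsDomain R] in
lemma diffForm_zero_one_ne_zero (hx₀ : ∀ i, x i ≠ 0) : diffForm x 0 1 ≠ 0 := by
  intro h
  have := congrArg (eval ![1, 0, 0]) h
  simp [diffForm, hx₀ 0] at this

/-- The linear forms `x_0 T_0 - x_1 T_1` and `x_1 T_1 - x_2 T_2` are coprime. -/
lemma IsCoprimeTriple.exists_of_diffForm_mul_add_eq_zero [UniqueFactorizationMonoid R]
    (hx : IsCoprimeTriple x) (hx₀ : ∀ i, x i ≠ 0) {u v : MvPolynomial (Fin 3) R}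
    (h : diffForm x 0 1 * u + diffForm x 1 2 * v = 0) :
    ∃ q, diffForm x 1 2 * q = u ∧ -(diffForm x 0 1 * q) = v := by
  have hprime := (hx.irreducible_diffForm hx₀).prime
  have hdvd : diffForm x 0 1 ∣ diffForm x 1 2 * v := ⟨-u, by linear_combination h⟩
  obtain hd | ⟨w, rfl⟩ := hprime.dvd_or_dvd hdvd
  · -- the point `(x_1, x_0, 0)` is a zero of the first form but not of the second
    exfalso
    obtain ⟨c, hc⟩ := hd
    have := congrArg (eval ![x 1, x 0, 0]) hc
    simp [diffForm, hx₀, mul_comm] at this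
  · refine ⟨-w, mul_left_cancel₀ (diffForm_zero_one_ne_zero hx₀) ?_, by ring⟩
    linear_combination -h

omit [IsDomain R] in
lemma homogeneousComponent_mul_of_left {a : MvPolynomial (Fin 3) R} {i : ℕ}
    (ha : a.IsHomogeneous i) (b : MvPolynomial (Fin 3) R) (j : ℕ) :
    homogeneousComponent (j + i) (a * b) = a * homogeneousComponent j b := by
  rw [add_comm]
  let _ := MvPolynomial.gradedAlgebra (σ := Fin 3) (R := R)
  have := DirectSum.coe_decompose_mul_add_of_left_mem
    (homogeneousSubmodule (Fin 3) R) (j := j) (b := b) ha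
  rwa [← decomposition.decompose'_apply, ← decomposition.decompose'_apply]

/-- A form of positive degree that vanishes at the pairwise products is a combination of the two
linear relations with forms as coefficients. -/
lemma IsCoprimeTriple.exists_isHomogeneous_of_aeval_eq_zero (hx : IsCoprimeTriple x)
    (hx₀ : ∀ i, x i ≠ 0) {n : ℕ} {p : MvPolynomial (Fin 3) R} (hp : p.IsHomogeneous (n + 1))
    (h : aeval (coProd x) p = 0) :
    ∃ u v, u.IsHomogeneous n ∧ v.IsHomogeneous n ∧
      diffForm x 0 1 * u + diffForm x 1 2 * v = p := by
  obtain ⟨u, v, huv⟩ := (mem_diffIdeal_iff x (i := 0) (j := 1) (k := 2) (by decide) (by decide)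
    (by decide)).1 (hx.mem_diffIdeal_of_aeval_eq_zero hx₀ hp h)
  refine ⟨_, _, homogeneousComponent_isHomogeneous n u, homogeneousComponent_isHomogeneous n v, ?_⟩
  rw [← homogeneousComponent_mul_of_left (diffForm_isHomogeneous x 0 1),
    ← homogeneousComponent_mul_of_left (diffForm_isHomogeneous x 1 2), ← map_add, diffForm, diffForm,
    mul_comm _ u, mul_comm _ v, huv, homogeneousComponent_eq_self hp]

/-- The syzygies between the two linear relations are the Koszul ones, degree by degree. -/
lemma IsCoprimeTriple.exists_isHomogeneous_of_diffForm_mul_add_eq_zero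
    [UniqueFactorizationMonoid R] (hx : IsCoprimeTriple x) (hx₀ : ∀ i, x i ≠ 0) {n : ℕ}
    {u v : MvPolynomial (Fin 3) R} (hu : u.IsHomogeneous (n + 1)) (hv : v.IsHomogeneous (n + 1))
    (h : diffForm x 0 1 * u + diffForm x 1 2 * v = 0) :
    ∃ q, q.IsHomogeneous n ∧ diffForm x 1 2 * q = u ∧ -(diffForm x 0 1 * q) = v := by
  obtain ⟨q, hqu, hqv⟩ := hx.exists_of_diffForm_mul_add_eq_zero hx₀ h
  refine ⟨_, homogeneousComponent_isHomogeneous n q, ?_, ?_⟩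
  · rw [← homogeneousComponent_mul_of_left (diffForm_isHomogeneous x 1 2), hqu,
      homogeneousComponent_eq_self hu]
  · rw [← homogeneousComponent_mul_of_left (diffForm_isHomogeneous x 0 1), ← map_neg, hqv,
      homogeneousComponent_eq_self hv]

end Syzygies

/-! ### Products over disjoint sets of variables -/

section Monomials

variable {K : Type u} [Field K] {V : Type v}

/-- Monomials in disjoint sets of variables: one is a nonzerodivisor modulo the others. -/
lemma mem_span_monomial_of_monomial_mul_mem {σ : Type*} {s : Set (σ →₀ ℕ)} {k : σ →₀ ℕ}
    (hk : ∀ t ∈ s, ∀ a, t a = 0 ∨ k a = 0) {q : MvPolynomial σ K}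
    (hq : monomial k 1 * q ∈ Ideal.span ((fun s => monomial s (1 : K)) '' s)) :
    q ∈ Ideal.span ((fun s => monomial s (1 : K)) '' s) := by
  rw [mem_ideal_span_monomial_image] at hq ⊢
  intro e he
  obtain ⟨t, hts, ht⟩ := hq (k + e) (by
    rw [mem_support_iff, coeff_monomial_mul, one_mul]
    exact mem_support_iff.1 he)
  refine ⟨t, hts, fun a => ?_⟩
  have := ht a
  rw [Finsupp.add_apply] at this
  obtain h | h := hk t hts a <;> omega

/-- The product of the variables in the `i`-th part. -/
noncomputable def partProd (K : Type u) [Field K] {V : Type v} (P : Fin 3 → Finset V) (i : Fin 3) :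
    MvPolynomial V K :=
  ∏ a ∈ P i, X a

lemma partProd_ne_zero (P : Fin 3 → Finset V) (i : Fin 3) : partProd K P i ≠ 0 :=
  Finset.prod_ne_zero_iff.2 fun a _ => X_ne_zero a

lemma isCoprimeTriple_partProd {P : Fin 3 → Finset V}
    (hP : ∀ i j, i ≠ j → Disjoint (P i) (P j)) : IsCoprimeTriple (partProd K P) := by
  classical
  let e := sumAlgEquiv K (Fin 3) V
  let m : Fin 3 → (Fin 3 ⊕ V →₀ ℕ) := fun i => ∑ a ∈ P i, Finsupp.single (Sum.inr a) 1
  let n : Fin 3 → (Fin 3 ⊕ V →₀ ℕ) := fun i => m i + Finsupp.single (Sum.inl i) 1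
  have he (i) : e (monomial (m i) 1) = C (partProd K P i) := by
    simp only [m, e, partProd, monomial_sum_one, map_prod]
    refine Finset.prod_congr rfl fun a _ => sumAlgEquiv_X_inr ..
  have he' (i) : e (monomial (n i) 1) = C (partProd K P i) * X i := by
    have : (monomial (n i) (1 : K)) = monomial (m i) 1 * X (Sum.inl i) := by
      rw [X, monomial_mul, one_mul]
    rw [this, map_mul, he]
    congr 1
    exact sumAlgEquiv_X_inl ..
  have hm (i a) : m i (Sum.inr a) = if a ∈ P i then 1 else 0 := by
    simp [m, Finsupp.finsetSum_apply, Finsupp.single_apply]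
  have hm' (i j) : m i (Sum.inl j) = 0 := by
    simp [m, Finsupp.finsetSum_apply]
  have hdisj {i j} (hij : i ≠ j) (a) : n i a = 0 ∨ n j a = 0 := by
    obtain a | a := a
    · simp only [n, Finsupp.add_apply, hm', Finsupp.single_apply]
      by_cases h : i = a
      · right; simp [h ▸ hij.symm]
      · left; simp [h]
    · have : a ∈ P i → a ∉ P j := fun h => Finset.disjoint_left.1 (hP i j hij) h
      simp only [n, Finsupp.add_apply, hm, Finsupp.single_apply]
      by_cases h : a ∈ P i <;> simp_all
  have hle (i a) : m i a = 0 ∨ n i a ≠ 0 := by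
    simp only [n, Finsupp.add_apply]; omega
  constructor
  · rintro i j hij q ⟨a, ha⟩
    have := mem_span_monomial_of_monomial_mul_mem (K := K) (s := {m i}) (k := n j)
      (q := e.symm q) (by
        rintro t rfl b
        have := hdisj hij b
        have := hle i b
        tauto)
      (by
        rw [Set.image_singleton, Ideal.mem_span_singleton]
        refine ⟨e.symm a, e.injective ?_⟩
        simp [he, he', ha])
    rw [Set.image_singleton, Ideal.mem_span_singleton] at this
    obtain ⟨b, hb⟩ := this
    refine ⟨e b, ?_⟩
    rw [← he, ← map_mul, ← hb, AlgEquiv.apply_symm_apply]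
  · intro i j k hij hik hjk q a b h
    have := mem_span_monomial_of_monomial_mul_mem (K := K) (s := {m i, n j}) (k := n k)
      (q := e.symm q) (by
        rintro t (rfl | rfl) b
        · have := hdisj hik b
          have := hle i b
          tauto
        · exact hdisj hjk b)
      (by
        rw [Set.image_pair, Ideal.mem_span_pair]
        refine ⟨e.symm a, e.symm b, e.injective ?_⟩
        simp only [map_add, map_mul, he, he', AlgEquiv.apply_symm_apply]
        rw [h]
        ring)
    rw [Set.image_pair, Ideal.mem_span_pair] at this
    obtain ⟨a', b', h'⟩ := this
    refine ⟨e a', e b', ?_⟩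
    rw [← he, ← he', ← map_mul, ← map_mul, ← map_add, mul_comm, mul_comm _ b', h',
      AlgEquiv.apply_symm_apply]

end Monomials

/-! ### Forms of degree `d` in three variables as vectors of coefficients -/

section Coefficients

variable {R : Type*} [CommRing R]

/-- The exponents of the monomials of degree `d` in three variables. -/
abbrev Expo (d : ℕ) : Type :=
  ↥(Finset.finsuppAntidiag (Finset.univ : Finset (Fin 3)) d)

lemma Expo.degree_eq {d : ℕ} (l : Expo d) : l.1.degree = d := by
  rw [Finsupp.degree_eq_sum]
  exact (Finset.mem_finsuppAntidiag.1 l.2).1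

/-- An exponent of degree `d`, as an element of `Expo d`. -/
def Expo.ofDegreeEq {d : ℕ} (l : Fin 3 →₀ ℕ) (h : l.degree = d) : Expo d :=
  ⟨l, Finset.mem_finsuppAntidiag.2 ⟨by rw [← Finsupp.degree_eq_sum, h], Finset.subset_univ _⟩⟩

lemma card_expo (d : ℕ) : Fintype.card (Expo d) = (d + 2).choose 2 := by
  rw [Fintype.card_coe, Finset.card_finsuppAntidiag_nat_eq_choose, Finset.card_univ,
    Fintype.card_fin, ← Nat.choose_symm_of_eq_add (show d + 2 = d + 2 from rfl)]
  congr 1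
  omega

/-- The form with a given vector of coefficients. -/
noncomputable def toForm (R : Type*) [CommRing R] (d : ℕ) :
    (Expo d → R) →ₗ[R] MvPolynomial (Fin 3) R :=
  ∑ l : Expo d, monomial l.1 ∘ₗ LinearMap.proj l

lemma toForm_apply {d : ℕ} (x : Expo d → R) : toForm R d x = ∑ l : Expo d, monomial l.1 (x l) := by
  simp [toForm]

lemma toForm_isHomogeneous {d : ℕ} (x : Expo d → R) : (toForm R d x).IsHomogeneous d := by
  rw [toForm_apply]
  exact IsHomogeneous.sum _ _ _ fun l _ => isHomogeneous_monomial _ l.degree_eq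

lemma coeff_toForm {d : ℕ} (x : Expo d → R) (l : Expo d) : coeff l.1 (toForm R d x) = x l := by
  classical
  rw [toForm_apply, coeff_sum, Finset.sum_eq_single l (fun k _ hk => ?_) (by simp)]
  · rw [coeff_monomial, if_pos rfl]
  · rw [coeff_monomial, if_neg (fun h => hk (Subtype.ext h))]

lemma toForm_coeff {d : ℕ} {p : MvPolynomial (Fin 3) R} (hp : p.IsHomogeneous d) :
    toForm R d (fun l => coeff l.1 p) = p := by
  ext l
  by_cases hl : l.degree = d
  · exact coeff_toForm _ (Expo.ofDegreeEq l hl)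
  · rw [hp.coeff_eq_zero hl, (toForm_isHomogeneous _).coeff_eq_zero hl]

lemma toForm_injective (d : ℕ) : Function.Injective (toForm R d) := fun x y h => by
  ext l
  rw [← coeff_toForm x, h, coeff_toForm]

/-- The matrix of multiplication by `f`, from forms of degree `d` to forms of degree `e`. -/
noncomputable def mulMatrix (f : MvPolynomial (Fin 3) R) (e d : ℕ) : Matrix (Expo e) (Expo d) R :=
  Matrix.of fun k l => coeff k.1 (f * monomial l.1 1)

lemma toForm_mulMatrix_mulVec {f : MvPolynomial (Fin 3) R} (hf : f.IsHomogeneous 1) {d : ℕ}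
    (x : Expo d → R) :
    toForm R (d + 1) ((mulMatrix f (d + 1) d).mulVec x) = f * toForm R d x := by
  have hfx : (f * toForm R d x).IsHomogeneous (d + 1) := by
    rw [add_comm]
    exact hf.mul (toForm_isHomogeneous x)
  rw [← toForm_coeff hfx]
  congr 1
  ext k
  rw [toForm_apply, Finset.mul_sum, coeff_sum]
  refine Finset.sum_congr rfl fun l _ => ?_
  have : monomial l.1 (x l) = C (x l) * monomial l.1 1 := by rw [C_mul_monomial, mul_one]
  rw [this, mul_left_comm, coeff_C_mul, mul_comm]
  rfl

/-- The entries of the matrix of multiplication by `x_i T_i - x_j T_j` are zero, `x_i` or `-x_j`,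
according to how the exponents of the row and of the column differ. -/
lemma mulMatrix_diffForm_induction (x : Fin 3 → R) {i j : Fin 3} (hij : i ≠ j) {d : ℕ}
    (k : Expo (d + 1)) (l : Expo d) {p : R → Prop} (h₀ : p 0)
    (hp : ∀ a : Fin 3, k.1 = l.1 + Finsupp.single a 1 → p (x a) ∧ p (-x a)) :
    p (mulMatrix (diffForm x i j) (d + 1) d k l) := by
  classical
  have h (a : Fin 3) : coeff k.1 (C (x a) * X a * monomial l.1 1) =
      if k.1 = l.1 + Finsupp.single a 1 then x a else 0 := by
    rw [C_mul_X_eq_monomial, monomial_mul, mul_one, coeff_monomial, add_comm]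
    simp only [eq_comm]
  rw [mulMatrix, Matrix.of_apply, diffForm, sub_mul, coeff_sub, h, h]
  by_cases hi : k.1 = l.1 + Finsupp.single i 1
  · have hj : k.1 ≠ l.1 + Finsupp.single j 1 := fun hj =>
      hij (Finsupp.single_left_injective one_ne_zero (add_left_cancel (hi.symm.trans hj)))
    rw [if_pos hi, if_neg hj, sub_zero]
    exact (hp i hi).1
  · by_cases hj : k.1 = l.1 + Finsupp.single j 1
    · rw [if_neg hi, if_pos hj, zero_sub]
      exact (hp j hj).2
    · rwa [if_neg hi, if_neg hj, sub_zero]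

end Coefficients

/-! ### Resolutions with bases indexed by arbitrary finite types -/

/-- A graded free resolution whose free modules have bases indexed by finite types `κ i`. -/
noncomputable def GradedFreeResolution.ofFintype {K : Type u} [Field K] {V : Type v} {M : Type w}
    [AddCommGroup M] [Module K M] [Module (MvPolynomial V K) M] {ℳ : ℤ → Submodule K M}
    (κ : ℕ → Type) [∀ i, Fintype (κ i)] [DecidableEq (κ 0)] (deg : ∀ i, κ i → ℤ)
    (D : ∀ i, Matrix (κ i) (κ (i + 1)) (MvPolynomial V K))
    (ε : (κ 0 → MvPolynomial V K) →ₗ[MvPolynomial V K] M)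
    (hD : ∀ i a b, D i a b ∈ polyGrading K V (deg (i + 1) b - deg i a))
    (hε : ∀ b, ε (Pi.single b 1) ∈ ℳ (deg 0 b)) (hε' : Function.Surjective ε)
    (h₀ : Function.Exact (D 0).mulVec ε)
    (h : ∀ i, Function.Exact (D (i + 1)).mulVec (D i).mulVec) : GradedFreeResolution V ℳ where
  rank i := Fintype.card (κ i)
  deg i b := deg i ((Fintype.equivFin (κ i)).symm b)
  diff i := (D i).submatrix (Fintype.equivFin _).symm (Fintype.equivFin _).symm
  aug := ε ∘ₗ LinearMap.funLeft _ _ (Fintype.equivFin _)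
  diff_mem i a b := hD i _ _
  aug_mem b := by
    have : (LinearMap.funLeft (MvPolynomial V K) (MvPolynomial V K) (Fintype.equivFin (κ 0)))
        (Pi.single b 1) = Pi.single ((Fintype.equivFin (κ 0)).symm b) 1 := by
      ext1 a
      simp [LinearMap.funLeft_apply, Pi.single_apply, Equiv.eq_symm_apply]
    rw [LinearMap.comp_apply, this]
    exact hε _
  aug_surjective := hε'.comp (LinearMap.funLeft_surjective_of_injective _ _ _
    (Fintype.equivFin _).injective)
  exact_aug x := by
    rw [LinearMap.comp_apply, h₀]
    constructor
    · rintro ⟨y, hy⟩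
      refine ⟨y ∘ (Fintype.equivFin _).symm, ?_⟩
      rw [Matrix.mulVecLin_apply, Matrix.submatrix_mulVec_equiv]
      ext1 a
      simp [Function.comp_assoc, hy, LinearMap.funLeft_apply]
    · rintro ⟨y, rfl⟩
      refine ⟨y ∘ Fintype.equivFin _, ?_⟩
      rw [Matrix.mulVecLin_apply, Matrix.submatrix_mulVec_equiv]
      ext1 a
      simp [LinearMap.funLeft_apply]
  exact_diff i x := by
    have hx : ((D i).submatrix (Fintype.equivFin _).symm (Fintype.equivFin _).symm).mulVecLin x = 0
        ↔ (D i).mulVec (x ∘ Fintype.equivFin _) = 0 := by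
      rw [Matrix.mulVecLin_apply, Matrix.submatrix_mulVec_equiv, Equiv.symm_symm]
      exact ⟨fun e => funext fun a => by simpa using congrFun e (Fintype.equivFin _ a),
        fun e => by rw [e]; rfl⟩
    rw [hx, h i]
    constructor
    · rintro ⟨y, hy⟩
      refine ⟨y ∘ (Fintype.equivFin _).symm, ?_⟩
      rw [Matrix.mulVecLin_apply, Matrix.submatrix_mulVec_equiv]
      ext1 a
      simp [Function.comp_assoc, hy]
    · rintro ⟨y, rfl⟩
      refine ⟨y ∘ Fintype.equivFin _, ?_⟩
      rw [Matrix.mulVecLin_apply, Matrix.submatrix_mulVec_equiv]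
      ext1 a
      simp

/-! ### The resolution of a power of the ideal of pairwise products -/

section Resolution

variable {K : Type u} [Field K] {V : Type v}

lemma partProd_mem_polyGrading (P : Fin 3 → Finset V) (i : Fin 3) :
    partProd K P i ∈ polyGrading K V (P i).card := by
  have := IsWeightedHomogeneous.prod (P i) (fun a => (X a : MvPolynomial V K)) (fun _ => (1 : ℤ))
    (w := fun _ : V => (1 : ℤ)) (fun a _ => isWeightedHomogeneous_X K _ a)
  rw [Finset.sum_const, nsmul_one] at this
  exact this

lemma coProd_mem_polyGrading (P : Fin 3 → Finset V) (i : Fin 3) :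
    coProd (partProd K P) i ∈ polyGrading K V ((∑ j, ((P j).card : ℤ)) - (P i).card) := by
  have := IsWeightedHomogeneous.prod {i}ᶜ (partProd K P) (fun j => ((P j).card : ℤ))
    (w := fun _ : V => (1 : ℤ)) (fun j _ => partProd_mem_polyGrading P j)
  rw [Fintype.sum_eq_add_sum_compl i, add_sub_cancel_left]
  exact this

lemma partProd_mem_span_X {P : Fin 3 → Finset V} (hP : ∀ i, (P i).Nonempty) (i : Fin 3) :
    partProd K P i ∈ Ideal.span (Set.range (X : V → MvPolynomial V K)) := by
  obtain ⟨a, ha⟩ := hP i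
  exact Ideal.mem_of_dvd _ (Finset.dvd_prod_of_mem _ ha) (Ideal.subset_span ⟨a, rfl⟩)

lemma coProd_mem_span_X {P : Fin 3 → Finset V} (hP : ∀ i, (P i).Nonempty) (i : Fin 3) :
    coProd (partProd K P) i ∈ Ideal.span (Set.range (X : V → MvPolynomial V K)) := by
  obtain ⟨j, hj⟩ := exists_ne i
  exact Ideal.mem_of_dvd _ (Finset.dvd_prod_of_mem _ (by simpa using hj))
    (partProd_mem_span_X hP j)

/-- The degree of the monomial `∏_i (∏_{j ≠ i} x_j) ^ l_i`, where `x_j` has degree `m_j`. -/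
def expoDeg (m : Fin 3 → ℕ) (l : Fin 3 →₀ ℕ) : ℤ :=
  ∑ i, l i * ((∑ j, (m j : ℤ)) - m i)

lemma expoDeg_add_single (m : Fin 3 → ℕ) (l : Fin 3 →₀ ℕ) (a : Fin 3) :
    expoDeg m (l + Finsupp.single a 1) = expoDeg m l + ((∑ j, (m j : ℤ)) - m a) := by
  simp [expoDeg, add_mul, Finset.sum_add_distrib, Finsupp.single_apply]

lemma mulMatrix_diffForm_mem_polyGrading (P : Fin 3 → Finset V) {i j : Fin 3} (hij : i ≠ j) {d : ℕ}
    (k : Expo (d + 1)) (l : Expo d) {t : ℤ}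
    (ht : t = expoDeg (fun i => (P i).card) l + (∑ j, ((P j).card : ℤ)) -
      expoDeg (fun i => (P i).card) k) :
    mulMatrix (diffForm (partProd K P) i j) (d + 1) d k l ∈ polyGrading K V t := by
  refine mulMatrix_diffForm_induction _ hij k l (p := (· ∈ polyGrading K V t)) (zero_mem _)
    fun a ha => ?_
  obtain rfl : t = (P a).card := by rw [ht, ha, expoDeg_add_single]; ring
  exact ⟨partProd_mem_polyGrading P a, Submodule.neg_mem _ (partProd_mem_polyGrading P a)⟩

lemma mulMatrix_diffForm_mem_span_X {P : Fin 3 → Finset V} (hP : ∀ i, (P i).Nonempty)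
    {i j : Fin 3} (hij : i ≠ j) {d : ℕ} (k : Expo (d + 1)) (l : Expo d) :
    mulMatrix (diffForm (partProd K P) i j) (d + 1) d k l ∈
      Ideal.span (Set.range (X : V → MvPolynomial V K)) :=
  mulMatrix_diffForm_induction _ hij k l
    (p := (· ∈ Ideal.span (Set.range (X : V → MvPolynomial V K)))) (zero_mem _)
    fun a _ => ⟨partProd_mem_span_X hP a, (Ideal.neg_mem_iff _).2 (partProd_mem_span_X hP a)⟩

/-- Evaluation of forms of degree `d` at the pairwise products. -/
noncomputable def strandAug {R : Type*} [CommRing R] (x : Fin 3 → R) (d : ℕ) :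
    (Expo d → R) →ₗ[R] ↥(Ideal.span (Set.range (coProd x)) ^ d) :=
  LinearMap.codRestrict _ ((aeval (coProd x)).toLinearMap ∘ₗ toForm R d) fun y =>
    (Ideal.mem_span_pow_iff_exists_isHomogeneous _ _).2
      ⟨_, toForm_isHomogeneous y, by rw [LinearMap.comp_apply]; simp⟩

/-- Multiplication by `x_0 T_0 - x_1 T_1` and `x_1 T_1 - x_2 T_2`, on pairs of forms of
degree `d`. -/
noncomputable def koszulRow {R : Type*} [CommRing R] (x : Fin 3 → R) (d : ℕ) :
    Matrix (Expo (d + 1)) (Expo d ⊕ Expo d) R :=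
  Matrix.fromCols (mulMatrix (diffForm x 0 1) (d + 1) d) (mulMatrix (diffForm x 1 2) (d + 1) d)

/-- The Koszul relation between `x_0 T_0 - x_1 T_1` and `x_1 T_1 - x_2 T_2`, on forms of
degree `d`. -/
noncomputable def koszulCol {R : Type*} [CommRing R] (x : Fin 3 → R) (d : ℕ) :
    Matrix (Expo (d + 1) ⊕ Expo (d + 1)) (Expo d) R :=
  Matrix.fromRows (mulMatrix (diffForm x 1 2) (d + 1) d) (-mulMatrix (diffForm x 0 1) (d + 1) d)

section Exact

variable {R : Type*} [CommRing R] {x : Fin 3 → R} {d : ℕ}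

lemma coe_strandAug (y : Expo d → R) :
    (strandAug x d y).1 = aeval (coProd x) (toForm R d y) := by
  rw [strandAug, LinearMap.codRestrict_apply, LinearMap.comp_apply, AlgHom.toLinearMap_apply]

lemma strandAug_surjective (x : Fin 3 → R) (d : ℕ) : Function.Surjective (strandAug x d) := by
  rintro ⟨y, hy⟩
  obtain ⟨p, hp, rfl⟩ := (Ideal.mem_span_pow_iff_exists_isHomogeneous _ _).1 hy
  refine ⟨fun l => coeff l.1 p, Subtype.ext ?_⟩
  rw [coe_strandAug, toForm_coeff hp]
  simp

lemma toForm_koszulRow_mulVec (y : Expo d ⊕ Expo d → R) :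
    toForm R (d + 1) ((koszulRow x d).mulVec y) =
      diffForm x 0 1 * toForm R d (y ∘ Sum.inl) + diffForm x 1 2 * toForm R d (y ∘ Sum.inr) := by
  rw [koszulRow, Matrix.fromCols_mulVec, map_add,
    toForm_mulMatrix_mulVec (diffForm_isHomogeneous x 0 1),
    toForm_mulMatrix_mulVec (diffForm_isHomogeneous x 1 2)]

lemma toForm_koszulCol_mulVec_inl (y : Expo d → R) :
    toForm R (d + 1) ((koszulCol x d).mulVec y ∘ Sum.inl) = diffForm x 1 2 * toForm R d y := by
  rw [koszulCol, Matrix.fromRows_mulVec, Sum.elim_comp_inl,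
    toForm_mulMatrix_mulVec (diffForm_isHomogeneous x 1 2)]

lemma toForm_koszulCol_mulVec_inr (y : Expo d → R) :
    toForm R (d + 1) ((koszulCol x d).mulVec y ∘ Sum.inr) = -(diffForm x 0 1 * toForm R d y) := by
  rw [koszulCol, Matrix.fromRows_mulVec, Sum.elim_comp_inr, Matrix.neg_mulVec, map_neg,
    toForm_mulMatrix_mulVec (diffForm_isHomogeneous x 0 1)]

lemma aeval_coProd_diffForm (x : Fin 3 → R) (i j : Fin 3) :
    aeval (coProd x) (diffForm x i j) = 0 := by
  simp [diffForm, mul_coProd]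

variable [IsDomain R]

lemma IsCoprimeTriple.exact_koszulRow_strandAug (hx : IsCoprimeTriple x) (hx₀ : ∀ i, x i ≠ 0) :
    Function.Exact (koszulRow x d).mulVec (strandAug x (d + 1)) := by
  intro y
  rw [← Subtype.coe_inj, coe_strandAug]
  constructor
  · intro h
    obtain ⟨u, v, hu, hv, huv⟩ := hx.exists_isHomogeneous_of_aeval_eq_zero hx₀ (n := d)
      (toForm_isHomogeneous y) h
    refine ⟨Sum.elim (fun l => coeff l.1 u) (fun l => coeff l.1 v), toForm_injective _ ?_⟩
    rw [toForm_koszulRow_mulVec, Sum.elim_comp_inl, Sum.elim_comp_inr, toForm_coeff hu,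
      toForm_coeff hv, huv]
  · rintro ⟨z, rfl⟩
    rw [toForm_koszulRow_mulVec, map_add, map_mul, map_mul, aeval_coProd_diffForm,
      aeval_coProd_diffForm, zero_mul, zero_mul, add_zero]
    rfl

lemma IsCoprimeTriple.exact_koszulCol_koszulRow [UniqueFactorizationMonoid R]
    (hx : IsCoprimeTriple x) (hx₀ : ∀ i, x i ≠ 0) :
    Function.Exact (koszulCol x d).mulVec (koszulRow x (d + 1)).mulVec := by
  intro y
  rw [← (toForm_injective (R := R) (d + 1 + 1)).eq_iff, toForm_koszulRow_mulVec, map_zero]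
  constructor
  · intro h
    obtain ⟨q, hq, hqu, hqv⟩ := hx.exists_isHomogeneous_of_diffForm_mul_add_eq_zero hx₀ (n := d)
      (toForm_isHomogeneous _)
      (toForm_isHomogeneous _) h
    have h₁ := toForm_koszulCol_mulVec_inl (x := x) (fun l : Expo d => coeff l.1 q)
    have h₂ := toForm_koszulCol_mulVec_inr (x := x) (fun l : Expo d => coeff l.1 q)
    rw [toForm_coeff hq, hqu] at h₁
    rw [toForm_coeff hq, hqv] at h₂
    refine ⟨fun l => coeff l.1 q, ?_⟩
    ext (l | l)
    · exact congrFun (toForm_injective _ h₁) l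
    · exact congrFun (toForm_injective _ h₂) l
  · rintro ⟨z, rfl⟩
    rw [toForm_koszulCol_mulVec_inl, toForm_koszulCol_mulVec_inr]
    ring

lemma koszulCol_mulVec_eq_zero_iff (hx₀ : ∀ i, x i ≠ 0) (y : Expo d → R) :
    (koszulCol x d).mulVec y = 0 ↔ y = 0 := by
  refine ⟨fun h => toForm_injective d ?_, fun h => by rw [h, Matrix.mulVec_zero]⟩
  have := toForm_koszulCol_mulVec_inr (x := x) y
  rw [h, Pi.zero_comp, map_zero, zero_eq_neg] at this
  rw [(mul_eq_zero.1 this).resolve_left (diffForm_zero_one_ne_zero hx₀), map_zero]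

end Exact

/-- The basis of the `i`-th module in the strand of degree `n + 2` of the Koszul complex of the two
linear relations. -/
def StrandIndex (n : ℕ) : ℕ → Type
  | 0 => Expo (n + 1 + 1)
  | 1 => Expo (n + 1) ⊕ Expo (n + 1)
  | 2 => Expo n
  | _ + 3 => PEmpty

instance (n : ℕ) : ∀ i, Fintype (StrandIndex n i)
  | 0 => inferInstanceAs (Fintype (Expo (n + 1 + 1)))
  | 1 => inferInstanceAs (Fintype (Expo (n + 1) ⊕ Expo (n + 1)))
  | 2 => inferInstanceAs (Fintype (Expo n))
  | _ + 3 => inferInstanceAs (Fintype PEmpty)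

instance (n : ℕ) : DecidableEq (StrandIndex n 0) :=
  inferInstanceAs (DecidableEq (Expo (n + 1 + 1)))

/-- The degrees of the basis elements of the strand: both relations have degree `m_0 + m_1 + m_2`. -/
def strandDeg (m : Fin 3 → ℕ) (n : ℕ) : ∀ i, StrandIndex n i → ℤ
  | 0 => fun l : Expo (n + 1 + 1) => expoDeg m l
  | 1 => Sum.elim (fun l : Expo (n + 1) => expoDeg m l + ∑ j, (m j : ℤ))
      (fun l : Expo (n + 1) => expoDeg m l + ∑ j, (m j : ℤ))
  | 2 => fun l : Expo n => expoDeg m l + 2 * ∑ j, (m j : ℤ)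
  | _ + 3 => fun b => PEmpty.elim b

/-- The differentials of the strand of degree `n + 2` of the Koszul complex of
`x_0 T_0 - x_1 T_1` and `x_1 T_1 - x_2 T_2`. -/
noncomputable def strandDiff {R : Type*} [CommRing R] (x : Fin 3 → R) (n : ℕ) :
    ∀ i, Matrix (StrandIndex n i) (StrandIndex n (i + 1)) R
  | 0 => koszulRow x (n + 1)
  | 1 => koszulCol x n
  | _ + 2 => fun _ b => PEmpty.elim b

lemma IsCoprimeTriple.exact_strandDiff {R : Type*} [CommRing R] [IsDomain R]
    [UniqueFactorizationMonoid R] {x : Fin 3 → R} {n : ℕ} (hx : IsCoprimeTriple x)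
    (hx₀ : ∀ i, x i ≠ 0) :
    ∀ i, Function.Exact (strandDiff x n (i + 1)).mulVec (strandDiff x n i).mulVec
  | 0 => hx.exact_koszulCol_koszulRow hx₀
  | 1 => fun y => by
    refine (koszulCol_mulVec_eq_zero_iff hx₀ y).trans ⟨?_, ?_⟩
    · rintro rfl
      exact ⟨0, Matrix.mulVec_zero _⟩
    · rintro ⟨z, rfl⟩
      have : strandDiff x n (1 + 1) = 0 := Matrix.ext fun _ b => PEmpty.elim b
      rw [this]
      exact Matrix.zero_mulVec _
  | i + 2 => fun y => by
    have h : ∀ z w : StrandIndex n (i + 3) → R, z = w := fun z w => funext fun b => PEmpty.elim b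
    refine ⟨fun _ => ⟨0, h _ _⟩, fun _ => ?_⟩
    rw [h y 0, Matrix.mulVec_zero]

lemma strandDiff_mem_polyGrading (P : Fin 3 → Finset V) (n : ℕ) : ∀ i a b,
    strandDiff (partProd K P) n i a b ∈ polyGrading K V
      (strandDeg (fun i => (P i).card) n (i + 1) b - strandDeg (fun i => (P i).card) n i a)
  | 0, a, Sum.inl b => mulMatrix_diffForm_mem_polyGrading P (by decide) a b rfl
  | 0, a, Sum.inr b => mulMatrix_diffForm_mem_polyGrading P (by decide) a b rfl
  | 1, Sum.inl a, b => mulMatrix_diffForm_mem_polyGrading P (by decide) a b (by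
      simp only [strandDeg, Sum.elim_inl]; ring)
  | 1, Sum.inr a, b => Submodule.neg_mem _ (mulMatrix_diffForm_mem_polyGrading P (by decide) a b (by
      simp only [strandDeg, Sum.elim_inr]; ring))
  | _ + 2, _, b => PEmpty.elim b

lemma strandDiff_mem_span_X {P : Fin 3 → Finset V} (hP : ∀ i, (P i).Nonempty) (n : ℕ) : ∀ i a b,
    strandDiff (partProd K P) n i a b ∈ Ideal.span (Set.range (X : V → MvPolynomial V K))
  | 0, a, Sum.inl b => mulMatrix_diffForm_mem_span_X hP (by decide) a b
  | 0, a, Sum.inr b => mulMatrix_diffForm_mem_span_X hP (by decide) a b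
  | 1, Sum.inl a, b => mulMatrix_diffForm_mem_span_X hP (by decide) a b
  | 1, Sum.inr a, b =>
    (Ideal.neg_mem_iff _).2 (mulMatrix_diffForm_mem_span_X hP (by decide) a b)
  | _ + 2, _, b => PEmpty.elim b

lemma strandAug_single_mem_idealGrading (P : Fin 3 → Finset V) {d : ℕ} (l : Expo d) :
    strandAug (partProd K P) d (Pi.single l 1) ∈
      idealGrading _ (expoDeg (fun i => (P i).card) l) := by
  change (strandAug (partProd K P) d (Pi.single l 1)).1 ∈ polyGrading K V _
  have h : toForm (MvPolynomial V K) d (Pi.single l 1) = monomial l.1 1 := by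
    rw [toForm_apply, Finset.sum_eq_single l (fun k _ hk => ?_) (by simp)]
    · rw [Pi.single_eq_same]
    · rw [Pi.single_eq_of_ne hk, map_zero]
  rw [coe_strandAug, h, aeval_monomial, map_one, one_mul, Finsupp.prod_fintype _ _ (by simp)]
  refine IsWeightedHomogeneous.prod Finset.univ (fun i => coProd (partProd K P) i ^ l.1 i)
    (fun i => l.1 i * ((∑ j, ((P j).card : ℤ)) - (P i).card)) fun i _ => ?_
  simpa using IsWeightedHomogeneous.pow (coProd_mem_polyGrading P i) (l.1 i)

/-- The strand of degree `n + 2` of the Koszul complex of the two linear relations, as a graded free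
resolution of the power of the ideal of pairwise products. -/
noncomputable def strandResolution (P : Fin 3 → Finset V)
    (hP : ∀ i j, i ≠ j → Disjoint (P i) (P j)) (n : ℕ) :
    GradedFreeResolution V
      (idealGrading (Ideal.span (Set.range (coProd (partProd K P))) ^ (n + 1 + 1))) :=
  GradedFreeResolution.ofFintype (StrandIndex n) (strandDeg (fun i => (P i).card) n)
    (strandDiff (partProd K P) n) (strandAug (partProd K P) (n + 1 + 1))
    (strandDiff_mem_polyGrading P n)
    (strandAug_single_mem_idealGrading P)
    (strandAug_surjective _ _)
    ((isCoprimeTriple_partProd hP).exact_koszulRow_strandAug (partProd_ne_zero P))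
    ((isCoprimeTriple_partProd hP).exact_strandDiff (partProd_ne_zero P))

lemma strandResolution_quotient_isMinimal {P : Fin 3 → Finset V} (hP₀ : ∀ i, (P i).Nonempty)
    (hP : ∀ i j, i ≠ j → Disjoint (P i) (P j)) (n : ℕ) :
    (strandResolution (K := K) P hP n).quotientResolution.IsMinimal
  | 0, _, b => by
    have hle : Ideal.span (Set.range (coProd (partProd K P))) ≤
        Ideal.span (Set.range (X : V → MvPolynomial V K)) := by
      rw [Ideal.span_le]
      rintro _ ⟨i, rfl⟩
      exact coProd_mem_span_X hP₀ i
    have h := ((strandResolution (K := K) P hP n).aug (Pi.single b 1)).2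
    exact hle (Ideal.pow_le_self (Nat.succ_ne_zero (n + 1)) h)
  | _ + 1, _, _ => strandDiff_mem_span_X hP₀ n _ _ _

lemma strandResolution_isMinimal {P : Fin 3 → Finset V} (hP₀ : ∀ i, (P i).Nonempty)
    (hP : ∀ i j, i ≠ j → Disjoint (P i) (P j)) (n : ℕ) :
    (strandResolution (K := K) P hP n).IsMinimal :=
  fun i => strandResolution_quotient_isMinimal hP₀ hP n (i + 1)

end Resolution

/-! ### The cover ideal -/

section CoverIdeal

variable {K : Type u} [Field K] {V : Type v}

lemma IsCompleteMultipartiteWithParts.disjoint {k : ℕ} {G : SimpleGraph V} {P : Fin k → Finset V}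
    (hG : IsCompleteMultipartiteWithParts G P) (i j : Fin k) (hij : i ≠ j) :
    Disjoint (P i) (P j) :=
  Finset.disjoint_left.2 fun a hi hj => hij ((hG.existsUnique_mem a).unique hi hj)

lemma coverIdeal_eq_span_coProd {G : SimpleGraph V} {P : Fin 3 → Finset V}
    (hG : IsCompleteMultipartiteWithParts G P) :
    coverIdeal K G = Ideal.span (Set.range (coProd (partProd K P))) := by
  classical
  have hco (i) : coProd (partProd K P) i = ∏ a ∈ Finset.biUnion {i}ᶜ P, X a :=
    (Finset.prod_biUnion fun j _ l _ h => hG.disjoint j l h).symm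
  refine le_antisymm (Ideal.span_le.2 ?_) (Ideal.span_le.2 ?_)
  · rintro _ ⟨c, hc, rfl⟩
    -- a vertex cover misses vertices of at most one part
    obtain ⟨i, hi⟩ : ∃ i, ∀ j ≠ i, P j ⊆ c := by
      by_cases hall : ∀ a, a ∈ c
      · exact ⟨0, fun j _ a _ => hall a⟩
      · obtain ⟨a, ha⟩ := not_forall.1 hall
        obtain ⟨i, hi, -⟩ := hG.existsUnique_mem a
        refine ⟨i, fun j hj b hb => ?_⟩
        exact (hc ((hG.adj_iff a b).2 ⟨i, j, hj.symm, hi, hb⟩)).resolve_left ha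
    refine Ideal.mem_of_dvd _ ?_ (Ideal.subset_span ⟨i, rfl⟩)
    rw [hco]
    refine Finset.prod_dvd_prod_of_subset _ _ _ (Finset.biUnion_subset.2 fun j hj => hi j ?_)
    simpa using hj
  · rintro _ ⟨i, rfl⟩
    refine Ideal.subset_span ⟨Finset.biUnion {i}ᶜ P, fun a b hab => ?_, hco i⟩
    obtain ⟨j, l, hjl, ha, hb⟩ := (hG.adj_iff a b).1 hab
    by_cases hj : j = i
    · right
      exact Finset.mem_coe.2 (Finset.mem_biUnion.2 ⟨l, by simpa using (hj ▸ hjl).symm, hb⟩)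
    · left
      exact Finset.mem_coe.2 (Finset.mem_biUnion.2 ⟨j, by simpa using hj, ha⟩)

end CoverIdeal

/-! ### Degrees and regularity -/

section Regularity

variable {K : Type u} [Field K] {V : Type v}

lemma Expo.sum_eq {d : ℕ} (l : Expo d) : l.1 0 + l.1 1 + l.1 2 = d := by
  have := Finsupp.degree_eq_sum l.1
  rw [l.degree_eq, Fin.sum_univ_three] at this
  exact this.symm

lemma exists_expo {d : ℕ} (a b c : ℕ) (h : a + b + c = d) :
    ∃ l : Expo d, l.1 0 = a ∧ l.1 1 = b ∧ l.1 2 = c :=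
  ⟨Expo.ofDegreeEq (Finsupp.equivFunOnFinite.symm ![a, b, c])
    (by simpa [Finsupp.degree_eq_sum, Fin.sum_univ_three] using h), rfl, rfl, rfl⟩

/-- The expected degrees are the degrees of the basis of the strand, each lowered by its homological
degree. The exponents `(ℓ_1, ℓ_2, ℓ_3)` correspond to `T_2, T_1, T_0`. -/
lemma mem_tripartiteDegrees_iff (m : Fin 3 → ℕ) (n : ℕ) (t : ℤ) :
    t ∈ tripartiteDegrees (m 0) (m 1) (m 2) (n + 2) ↔
      ∃ i, ∃ b : StrandIndex n i, strandDeg m n i b - i = t := by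
  constructor
  · rintro ⟨l₁, l₂, l₃, hs, ⟨-, -, -, rfl⟩ | ⟨h, -, -, -, rfl⟩ | ⟨h, -, -, -, rfl⟩⟩
    · obtain ⟨l, h0, h1, h2⟩ := exists_expo (d := n + 1 + 1) l₃ l₂ l₁ (by omega)
      refine ⟨0, l, ?_⟩
      simp only [strandDeg, expoDeg, tripartiteAlpha, Fin.sum_univ_three, h0, h1, h2, ← hs]
      push_cast
      ring
    · obtain ⟨l₁, rfl⟩ := Nat.exists_eq_add_of_le' h
      obtain ⟨l, h0, h1, h2⟩ := exists_expo (d := n + 1) l₃ l₂ l₁ (by omega)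
      refine ⟨1, Sum.inl l, ?_⟩
      simp only [strandDeg, Sum.elim_inl, expoDeg, tripartiteAlpha, Fin.sum_univ_three, h0, h1, h2,
        ← hs]
      push_cast
      ring
    · obtain ⟨l₁, rfl⟩ := Nat.exists_eq_add_of_le' h
      obtain ⟨l, h0, h1, h2⟩ := exists_expo (d := n) l₃ l₂ l₁ (by omega)
      refine ⟨2, l, ?_⟩
      simp only [strandDeg, expoDeg, tripartiteAlpha, Fin.sum_univ_three, h0, h1, h2, ← hs]
      push_cast
      ring
  · have key₁ (l : Expo (n + 1)) : expoDeg m l + ∑ j, (m j : ℤ) - 1 ∈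
        tripartiteDegrees (m 0) (m 1) (m 2) (n + 2) := by
      have hl := l.sum_eq
      refine ⟨l.1 2 + 1, l.1 1, l.1 0, by omega, Or.inr (Or.inl ⟨by omega, by omega, by omega,
        by omega, ?_⟩)⟩
      rw [show n + 2 = l.1 0 + l.1 1 + l.1 2 + 1 by omega]
      simp only [expoDeg, tripartiteAlpha, Fin.sum_univ_three]
      push_cast
      ring
    rintro ⟨_ | _ | _ | i, b, rfl⟩
    · have hl := Expo.sum_eq b
      refine ⟨b.1 2, b.1 1, b.1 0, by omega, Or.inl ⟨by omega, by omega, by omega, ?_⟩⟩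
      have hn : ((n + 2 : ℕ) : ℤ) = b.1 0 + b.1 1 + b.1 2 := by exact_mod_cast hl.symm
      simp only [strandDeg, expoDeg, tripartiteAlpha, Fin.sum_univ_three, hn]
      push_cast
      ring
    · obtain b | b := b
      · exact_mod_cast key₁ b
      · exact_mod_cast key₁ b
    · have hl := Expo.sum_eq b
      refine ⟨b.1 2 + 2, b.1 1, b.1 0, by omega, Or.inr (Or.inr ⟨by omega, by omega, by omega,
        by omega, ?_⟩)⟩
      rw [show n + 2 = b.1 0 + b.1 1 + b.1 2 + 2 by omega]
      simp only [strandDeg, expoDeg, tripartiteAlpha, Fin.sum_univ_three]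
      push_cast
      ring
    · exact PEmpty.elim b

lemma tripartiteDegrees_finite (m₁ m₂ m₃ s : ℕ) : (tripartiteDegrees m₁ m₂ m₃ s).Finite := by
  refine ((Set.finite_Iic (s, s, s)).biUnion fun l _ => Set.toFinite
    ({tripartiteAlpha m₁ m₂ m₃ s l.1 l.2.1 l.2.2, tripartiteAlpha m₁ m₂ m₃ s l.1 l.2.1 l.2.2 + m₃ - 1,
      tripartiteAlpha m₁ m₂ m₃ s l.1 l.2.1 l.2.2 + 2 * m₃ - 2} : Set ℤ)).subset ?_
  rintro x ⟨l₁, l₂, l₃, hs, h⟩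
  refine Set.mem_biUnion (x := (l₁, l₂, l₃)) ?_ ?_
  · exact ⟨by simp; omega, by simp; omega, by simp; omega⟩
  · rcases h with ⟨-, -, -, h⟩ | ⟨-, -, -, -, h⟩ | ⟨-, -, -, -, h⟩ <;> simp [h]

lemma exists_isGreatest_tripartiteDegrees (m₁ m₂ m₃ s : ℕ) :
    ∃ r, IsGreatest (tripartiteDegrees m₁ m₂ m₃ s) r := by
  have hne : (tripartiteDegrees m₁ m₂ m₃ s).Nonempty :=
    ⟨_, s, 0, 0, rfl, Or.inl ⟨le_rfl, s.zero_le, s.zero_le, rfl⟩⟩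
  obtain ⟨r, hr, hmax⟩ := Set.exists_max_image _ id (tripartiteDegrees_finite m₁ m₂ m₃ s) hne
  exact ⟨r, hr, fun x hx => hmax x hx⟩

/-- The regularity of a homogeneous ideal is read off from the degrees in a minimal graded free
resolution. -/
lemma GradedFreeResolution.IsMinimal.regularity_eq {I : Ideal (MvPolynomial V K)}
    {F : GradedFreeResolution V (idealGrading I)} (hF : F.IsMinimal) {r : ℤ}
    (hr : IsGreatest {t | ∃ i b, F.deg i b - i = t} r) :
    regularity V (idealGrading I) = ((r : ℝ) : EReal) := by
  obtain ⟨⟨i, b, hib⟩, hmax⟩ := hr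
  refine le_antisymm (iSup_le fun i => ?_) ?_
  · have h : topTorDegree V (idealGrading I) i ≤ (((r + i : ℤ) : ℝ) : EReal) := by
      refine iSup₂_le fun j hj => ?_
      obtain ⟨b, rfl⟩ := exists_deg_eq_of_torNonzero hj F
      have := hmax ⟨i, b, rfl⟩
      exact EReal.coe_le_coe_iff.2 (Int.cast_le.2 (by linarith))
    refine (EReal.sub_le_sub h le_rfl).trans ?_
    rw [← EReal.coe_sub, EReal.coe_le_coe_iff]
    push_cast
    linarith
  · refine le_iSup_of_le i ?_
    have h : (((F.deg i b : ℤ) : ℝ) : EReal) ≤ topTorDegree V (idealGrading I) i :=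
      le_iSup₂_of_le _ ⟨F, hF.nontrivial_tor i b⟩ le_rfl
    refine le_trans ?_ (EReal.sub_le_sub h le_rfl)
    rw [← EReal.coe_sub, EReal.coe_le_coe_iff, ← hib]
    push_cast
    exact le_rfl

end Regularity

theorem mainTheorem2 {K : Type u} [Field K] {V : Type v} [Fintype V] (G : SimpleGraph V)
    (P : Fin 3 → Finset V) (hG : IsCompleteMultipartiteWithParts G P) (s : ℕ) (hs : 2 ≤ s) :
    ((∃ F : GradedFreeResolution V (quotientGrading (coverIdeal K G ^ s)), F.IsMinimal) ∧
      ∀ F : GradedFreeResolution V (quotientGrading (coverIdeal K G ^ s)), F.IsMinimal →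
        F.rank 0 = 1 ∧ F.rank 1 = (s + 2).choose 2 ∧ F.rank 2 = 2 * (s + 1).choose 2 ∧
          F.rank 3 = s.choose 2 ∧ ∀ i, 4 ≤ i → F.rank i = 0) ∧
    ∃ r : ℤ, IsGreatest (tripartiteDegrees (P 0).card (P 1).card (P 2).card s) r ∧
      regularity V (idealGrading (coverIdeal K G ^ s)) = ((r : ℝ) : EReal) := by
  obtain ⟨n, rfl⟩ : ∃ n, s = n + 1 + 1 := ⟨s - 2, by omega⟩
  rw [coverIdeal_eq_span_coProd hG]
  have hmin := strandResolution_quotient_isMinimal (K := K) hG.nonempty hG.disjoint n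
  refine ⟨⟨⟨_, hmin⟩, fun F hF => ?_⟩, ?_⟩
  · have hrank := fun i => hF.rank_eq hmin i
    refine ⟨hrank 0, (hrank 1).trans (card_expo (n + 1 + 1)), (hrank 2).trans ?_,
      (hrank 3).trans (card_expo n), fun i hi => ?_⟩
    · exact (Fintype.card_sum (α := Expo (n + 1)) (β := Expo (n + 1))).trans
        (by rw [card_expo, two_mul])
    · obtain ⟨i, rfl⟩ := Nat.exists_eq_add_of_le' hi
      exact (hrank (i + 4)).trans (Fintype.card_eq_zero (α := PEmpty.{1}))
  · obtain ⟨r, hr⟩ := exists_isGreatest_tripartiteDegrees (P 0).card (P 1).card (P 2).card (n + 2)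
    refine ⟨r, hr, (strandResolution_isMinimal hG.nonempty hG.disjoint n).regularity_eq ?_⟩
    convert hr using 1
    ext t
    refine Iff.trans ?_ (mem_tripartiteDegrees_iff (fun i => (P i).card) n t).symm
    exact exists_congr fun i => ((Fintype.equivFin (StrandIndex n i)).symm.surjective.exists
      (p := fun b => strandDeg (fun i => (P i).card) n i b - i = t)).symm
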